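/- **Theorem (uniqueness of the prediction map).** *Inferential theory.* Let $\mathrm{SubStoch}$ be the symmetric monoidal category of finite sets and substochastic maps, whose systems are (bracketed) finite collections of wires labelled by finite sets, a collection having as its set of values the cartesian product of its labels: a map $X\to Y$ is a matrix $(M_{xy})_{x\in X,y\in Y}$ with entries $\ge 0$ and $\sum_y M_{xy}\le 1$ for all $x$; sequential composition is the matrix product, parallel composition is juxtaposition of wires and the Kronecker product of matrices, and the trivial system is the empty collection, with a singleton set of values. A function $f$ is regarded as the $0/1$ matrix sending $[x]$ to $[f(x)]$, where $[x]$ is the point distribution at $x$. *The theory F-S.* Let $\mathrm{F\text{-}S}$ be the symmetric monoidal category (process theory) whose systems are (bracketed) finite collections of wires, each wire being labelled by a finite set and being either causal or inferential, and whose processes are the diagrams generated by - every substochastic map $s:X\to Y$, as a process between inferential systems; - for causal systems $\Lambda,\Lambda'$, a process $\kappa_{\Lambda\Lambda'}$ with inputs the causal system $\Lambda$ and the inferential system $\overrightarrow{\Lambda\Lambda'}$ (the set of all functions $\Lambda\to\Lambda'$), and output the causal system $\Lambda'$ ("specify a state of knowledge about the dynamics"); - for each causal system $\Lambda$, a process $\ell_\Lambda$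 with input the causal system $\Lambda$ and outputs the causal system $\Lambda$ and the inferential system $\Lambda$ ("gain knowledge about $\Lambda$"); - for each causal system $\Lambda$, a process $\mathrm{ign}_\Lambda$ from the causal system $\Lambda$ to the trivial system ("ignore $\Lambda$"); two diagrams being equal iff they are related by the congruence generated by the laws of symmetric monoidal categories and the following rules. 1. Sequential and parallel composites, and the identity, swap and other bare wirings, of substochastic maps are those of $\mathrm{SubStoch}$; so there is a diagram-preserving map $\mathbf i':\mathrm{SubStoch}\to\mathrm{F\text{-}S}$. 2. $\kappa_{\Lambda\Lambda'}$ followed by $\kappa_{\Lambda'\Lambda''}$ equals $\kappa_{\Lambda\Lambda''}$ preceded by the map $[f]\otimes[g]\mapsto[g\circ f]$; and $\kappa_{\Lambda_1\Lambda_1'}\otimes\kappa_{\Lambda_2\Lambda_2'}$ equals $\kappa_{\Lambda_1\Lambda_2,\Lambda_1'\Lambda_2'}$ preceded by $[f]\otimes[g]\mapsto[f\times g]$. 3. If $f$ is the identity function, the swap, or another bare rewiring function, then $\kappa$ with the state $[f]$ inserted is that wiring of causal systems. 4. $\ell_\Lambda$ followed by marginalisation of its inferential output is the identity on $\Lambda$;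 $\ell_\Lambda$ applied twice in succession equals $\ell_\Lambda$ followed by the broadcasting map $[\lambda]\mapsto[\lambda]\otimes[\lambda]$; and $\ell_{\Lambda\Lambda'}=\ell_\Lambda\otimes\ell_{\Lambda'}$ (up to the order of the wires). 5. Ignoring a composite system is ignoring each component, ignoring the trivial system is the empty diagram, and $\kappa_{\Lambda\Lambda'}$ followed by $\mathrm{ign}_{\Lambda'}$ equals $\mathrm{ign}_\Lambda$ in parallel with marginalisation of $\overrightarrow{\Lambda\Lambda'}$. 6. $\kappa_{\Lambda\Lambda'}$ followed by $\ell_{\Lambda'}$ equals the following: apply $\ell_\Lambda$ and broadcast the inferential input $\overrightarrow{\Lambda\Lambda'}$; feed the causal system $\Lambda$ and one copy of $\overrightarrow{\Lambda\Lambda'}$ to $\kappa_{\Lambda\Lambda'}$; and feed the inferential output $\Lambda$ of $\ell_\Lambda$ and the other copy to the map $[\lambda]\otimes[f]\mapsto[f(\lambda)]$. *Prediction maps.* A process of $\mathrm{F\text{-}S}$ is causally closed if all its input and output wires are inferential; these processes form a sub-process-theory containing the image of $\mathbf i'$. A prediction map is a diagram-preserving map (strict symmetric monoidal functor) $\mathbf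 p^*$ from the causally closed processes of $\mathrm{F\text{-}S}$ to $\mathrm{SubStoch}$ such that $\mathbf p^*\circ\mathbf i'=\mathbb 1_{\mathrm{SubStoch}}$. *Claim.* There is exactly one prediction map $\mathbf p^*$. -/

import Mathlib

open CategoryTheory MonoidalCategory
open scoped NNReal

noncomputable section

namespace CausalInferential

/-! ### Systems -/

/-- A finite set. It labels the elementary systems, both of the causal theory (as the set of ontic
states) and of the inferential theory (as the range of a variable). -/
structure FinSet : Type 1 where
  carrier : Type
  [finite : Finite carrier]

/-- The systems of a process theory whose elementary wires carry labels in `α`: bracketed finite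
collections of wires, drawn next to each other. `unit` is the empty collection (the trivial
system). -/
inductive Sys (α : Type 1) : Type 1
  | unit : Sys α
  | wire (a : α) : Sys α
  | tensor (X Y : Sys α) : Sys α

namespace Sys

/-- Relabelling of the wires of a system. -/
abbrev map {α β : Type 1} (r : α → β) : Sys α → Sys β
  | unit => unit
  | wire a => wire (r a)
  | tensor X Y => tensor (map r X) (map r Y)

/-- Every wire of the system carries a label satisfying `P`. -/
def All {α : Type 1} (P : α → Prop) : Sys α → Prop
  | unit => True
  | wire a => P a
  | tensor X Y => All P X ∧ All P Y

/-- The set of values of a system of finite sets: composite systems are cartesian products, the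
trivial system is a singleton. -/
abbrev Val : Sys FinSet → Type
  | unit => Unit
  | wire a => a.carrier
  | tensor X Y => Val X × Val Y

instance fintypeVal : (X : Sys FinSet) → Fintype X.Val
  | unit => inferInstanceAs (Fintype Unit)
  | wire a => @Fintype.ofFinite a.carrier a.finite
  | tensor X Y =>
      letI := fintypeVal X
      letI := fintypeVal Y
      inferInstanceAs (Fintype (Val X × Val Y))

end Sys

namespace Sys

/-- Rebracketing. -/
def assocEquiv (X Y Z : Sys FinSet) : Val (tensor (tensor X Y) Z) ≃ Val (tensor X (tensor Y Z)) :=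
  Equiv.prodAssoc X.Val Y.Val Z.Val

/-- Removal of the trivial system on the left. -/
def lunitEquiv (X : Sys FinSet) : Val (tensor unit X) ≃ Val X := Equiv.punitProd X.Val

/-- Removal of the trivial system on the right. -/
def runitEquiv (X : Sys FinSet) : Val (tensor X unit) ≃ Val X := Equiv.prodPUnit X.Val

/-- Exchange of two systems. -/
def swapEquiv (X Y : Sys FinSet) : Val (tensor X Y) ≃ Val (tensor Y X) :=
  Equiv.prodComm X.Val Y.Val

/-- The cartesian product of two functions. -/
def prodMap {X Y X' Y' : Sys FinSet} (f : Val X → Val Y) (g : Val X' → Val Y') :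
    Val (tensor X X') → Val (tensor Y Y') :=
  Prod.map f g

end Sys

/-! ### The causal theory: functional dynamics -/

/-- A process of the theory `Func` of functional dynamics, from `A` to `B`: an arbitrary function
between the sets of ontic states. Sequential composition is composition of functions, parallel
composition is the cartesian product of functions. -/
abbrev Func (A B : Sys FinSet) : Type := A.Val → B.Val

/-- The set of all functions from `A` to `B`, as an elementary inferential system (one wire):
this is the variable that ranges over the possible dynamics from `A` to `B`. -/
abbrev funcSys (A B : Sys FinSet) : Sys FinSet :=
  .wire { carrier := Func A B, finite := Pi.finite }

/-! ### The inferential theory: substochastic maps -/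

/-- The systems of the process theory of substochastic maps. -/
abbrev SubStoch : Type 1 := Sys FinSet

namespace SubStoch

/-- A substochastic map from `X` to `Y`: a matrix with nonnegative entries `weight x y` (the weight
of the output `y` given the input `x`) such that the weights for each input sum to at most `1`. -/
@[ext]
structure Hom (X Y : Sys FinSet) : Type where
  weight : Matrix X.Val Y.Val ℝ≥0
  sum_le (x : X.Val) : ∑ y, weight x y ≤ 1

theorem Hom.ext' {X Y : Sys FinSet} {M N : Hom X Y} (h : ∀ x y, M.weight x y = N.weight x y) :
    M = N :=
  Hom.ext (Matrix.ext h)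

open Classical in
/-- The deterministic substochastic map of a function. -/
def det {X Y : Sys FinSet} (f : X.Val → Y.Val) : Hom X Y where
  weight := Matrix.of fun x y => if f x = y then 1 else 0
  sum_le x := by simp

/-- Sequential composition: matrix multiplication. -/
def comp {X Y Z : Sys FinSet} (M : Hom X Y) (N : Hom Y Z) : Hom X Z where
  weight := M.weight * N.weight
  sum_le x := by
    simp only [Matrix.mul_apply]
    rw [Finset.sum_comm]
    calc ∑ y, ∑ z, M.weight x y * N.weight y z = ∑ y, M.weight x y * ∑ z, N.weight y z := by
          simp only [Finset.mul_sum]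
      _ ≤ ∑ y, M.weight x y * 1 := by
          gcongr with y
          exact N.sum_le y
      _ ≤ 1 := by simpa using M.sum_le x

/-- Parallel composition: the Kronecker product of matrices. -/
def tensor {X Y X' Y' : Sys FinSet} (M : Hom X Y) (N : Hom X' Y') :
    Hom (.tensor X X') (.tensor Y Y') where
  weight := Matrix.of fun x y => M.weight x.1 y.1 * N.weight x.2 y.2
  sum_le x := by
    change ∑ y : Y.Val × Y'.Val, M.weight x.1 y.1 * N.weight x.2 y.2 ≤ 1
    rw [Fintype.sum_prod_type]
    simp only [← Finset.mul_sum, ← Finset.sum_mul]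
    exact mul_le_one' (M.sum_le x.1) (N.sum_le x.2)

theorem det_val {X Y : Sys FinSet} (f : X.Val → Y.Val) (x : X.Val) (y : Y.Val)
    [Decidable (f x = y)] : (det f).weight x y = if f x = y then 1 else 0 := by
  simp [det]

theorem det_comp_val {X Y Z : Sys FinSet} (f : X.Val → Y.Val) (M : Hom Y Z) (x : X.Val)
    (z : Z.Val) : (comp (det f) M).weight x z = M.weight (f x) z := by
  classical
  simp only [comp, det, Matrix.mul_apply, Matrix.of_apply, ite_mul, one_mul, zero_mul]
  rw [Finset.sum_eq_single (f x)]
  · simp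
  · intro y _ hy
    rw [if_neg hy.symm]
  · simp

theorem comp_det_val {X Y Z : Sys FinSet} (M : Hom X Y) (e : Y.Val ≃ Z.Val) (x : X.Val)
    (z : Z.Val) : (comp M (det e)).weight x z = M.weight x (e.symm z) := by
  classical
  simp only [comp, det, Matrix.mul_apply, Matrix.of_apply, mul_ite, mul_one, mul_zero]
  rw [Finset.sum_eq_single (e.symm z)]
  · simp
  · intro y _ hy
    rw [if_neg]
    rintro rfl
    simp at hy
  · simp

theorem tensor_val {X Y X' Y' : Sys FinSet} (M : Hom X Y) (N : Hom X' Y') (x : X.Val)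
    (x' : X'.Val) (y : Y.Val) (y' : Y'.Val) :
    (tensor M N).weight (x, x') (y, y') = M.weight x y * N.weight x' y' := rfl

theorem det_comp_det {X Y Z : Sys FinSet} (f : X.Val → Y.Val) (g : Y.Val → Z.Val) :
    comp (det f) (det g) = det (g ∘ f) := by
  refine Hom.ext' fun x z => ?_
  rw [det_comp_val]
  rfl

theorem tensor_det_det {X Y X' Y' : Sys FinSet} (f : X.Val → Y.Val) (g : X'.Val → Y'.Val) :
    tensor (det f) (det g) = det (Sys.prodMap f g) := by
  classical
  refine Hom.ext' ?_
  rintro ⟨x, x'⟩ ⟨y, y'⟩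
  have h : (if f x = y then (1 : ℝ≥0) else 0) * (if g x' = y' then 1 else 0) =
      if (f x, g x') = (y, y') then 1 else 0 := by
    by_cases h : f x = y <;> by_cases h' : g x' = y' <;> simp [h, h']
  rw [tensor_val, det_val, det_val, h]
  exact Eq.trans (by congr) (det_val (X := .tensor X X') (Y := .tensor Y Y')
    (Sys.prodMap f g) (x, x') (y, y')).symm

theorem det_id_comp {X Y : Sys FinSet} (M : Hom X Y) : comp (det id) M = M :=
  Hom.ext' fun _ _ => det_comp_val _ _ _ _

theorem comp_det_id {X Y : Sys FinSet} (M : Hom X Y) : comp M (det id) = M :=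
  Hom.ext' fun x y => comp_det_val M (Equiv.refl _) x y

theorem comp_assoc {W X Y Z : Sys FinSet} (L : Hom W X) (M : Hom X Y) (N : Hom Y Z) :
    comp (comp L M) N = comp L (comp M N) :=
  Hom.ext (Matrix.mul_assoc _ _ _)

theorem tensor_comp_tensor {X Y Z X' Y' Z' : Sys FinSet} (M : Hom X Y) (M' : Hom X' Y')
    (N : Hom Y Z) (N' : Hom Y' Z') :
    comp (tensor M M') (tensor N N') = tensor (comp M N) (comp M' N') := by
  refine Hom.ext' ?_
  rintro ⟨x, x'⟩ ⟨z, z'⟩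
  change ∑ y : Y.Val × Y'.Val,
      (M.weight x y.1 * M'.weight x' y.2) * (N.weight y.1 z * N'.weight y.2 z') =
    (∑ y, M.weight x y * N.weight y z) * ∑ y', M'.weight x' y' * N'.weight y' z'
  rw [Fintype.sum_prod_type, Finset.sum_mul_sum]
  refine Finset.sum_congr rfl fun y _ => Finset.sum_congr rfl fun y' _ => ?_
  ring

instance : Category SubStoch where
  Hom X Y := Hom X Y
  id _ := det id
  comp M N := comp M N
  id_comp := det_id_comp
  comp_id := comp_det_id
  assoc := comp_assoc

/-- The isomorphism of a bijection. -/
def detIso {X Y : SubStoch} (e : Sys.Val X ≃ Sys.Val Y) : X ≅ Y where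
  hom := det e
  inv := det e.symm
  hom_inv_id := (det_comp_det _ _).trans (by rw [Equiv.symm_comp_self]; rfl)
  inv_hom_id := (det_comp_det _ _).trans (by rw [Equiv.self_comp_symm]; rfl)

instance : MonoidalCategoryStruct SubStoch where
  tensorObj X Y := Sys.tensor X Y
  tensorUnit := Sys.unit
  tensorHom M N := tensor M N
  whiskerLeft X _ _ M := tensor (det (X := X) (Y := X) id) M
  whiskerRight M X := tensor M (det (X := X) (Y := X) id)
  associator X Y Z := detIso (Sys.assocEquiv X Y Z)
  leftUnitor X := detIso (Sys.lunitEquiv X)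
  rightUnitor X := detIso (Sys.runitEquiv X)

theorem assoc_nat {X₁ X₂ X₃ Y₁ Y₂ Y₃ : Sys FinSet} (f₁ : Hom X₁ Y₁) (f₂ : Hom X₂ Y₂)
    (f₃ : Hom X₃ Y₃) :
    comp (tensor (tensor f₁ f₂) f₃) (det (Sys.assocEquiv Y₁ Y₂ Y₃)) =
      comp (det (Sys.assocEquiv X₁ X₂ X₃)) (tensor f₁ (tensor f₂ f₃)) := by
  refine Hom.ext' fun x y => ?_
  rw [comp_det_val, det_comp_val]
  exact mul_assoc _ _ _

theorem lunit_nat {X Y : Sys FinSet} (f : Hom X Y) :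
    comp (tensor (det (X := .unit) (Y := .unit) id) f) (det (Sys.lunitEquiv Y)) =
      comp (det (Sys.lunitEquiv X)) f := by
  classical
  refine Hom.ext' fun x y => ?_
  rw [comp_det_val, det_comp_val]
  exact (congrArg (· * f.weight x.2 y) ((det_val _ _ _).trans (if_pos rfl))).trans (one_mul _)

theorem runit_nat {X Y : Sys FinSet} (f : Hom X Y) :
    comp (tensor f (det (X := .unit) (Y := .unit) id)) (det (Sys.runitEquiv Y)) =
      comp (det (Sys.runitEquiv X)) f := by
  classical
  refine Hom.ext' fun x y => ?_
  rw [comp_det_val, det_comp_val]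
  exact (congrArg (f.weight x.1 y * ·) ((det_val _ _ _).trans (if_pos rfl))).trans (mul_one _)

theorem swap_nat {X Y X' Y' : Sys FinSet} (f : Hom X Y) (g : Hom X' Y') :
    comp (tensor f g) (det (Sys.swapEquiv Y Y')) = comp (det (Sys.swapEquiv X X')) (tensor g f) := by
  refine Hom.ext' fun x y => ?_
  rw [comp_det_val, det_comp_val]
  exact mul_comm _ _

theorem pentagon (W X Y Z : Sys FinSet) :
    comp (tensor (det (Sys.assocEquiv W X Y)) (det (X := Z) (Y := Z) id))
        (comp (det (Sys.assocEquiv W (.tensor X Y) Z))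
          (tensor (det (X := W) (Y := W) id) (det (Sys.assocEquiv X Y Z)))) =
      comp (det (Sys.assocEquiv (.tensor W X) Y Z)) (det (Sys.assocEquiv W X (.tensor Y Z))) := by
  simp only [tensor_det_det, det_comp_det]
  rfl

theorem triangle (X Y : Sys FinSet) :
    comp (det (Sys.assocEquiv X .unit Y))
        (tensor (det (X := X) (Y := X) id) (det (Sys.lunitEquiv Y))) =
      tensor (det (Sys.runitEquiv X)) (det (X := Y) (Y := Y) id) := by
  simp only [tensor_det_det, det_comp_det]
  rfl

theorem hexagon (X Y Z : Sys FinSet) :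
    comp (det (Sys.assocEquiv X Y Z))
        (comp (det (Sys.swapEquiv X (.tensor Y Z))) (det (Sys.assocEquiv Y Z X))) =
      comp (tensor (det (Sys.swapEquiv X Y)) (det (X := Z) (Y := Z) id))
        (comp (det (Sys.assocEquiv Y X Z))
          (tensor (det (X := Y) (Y := Y) id) (det (Sys.swapEquiv X Z)))) := by
  simp only [tensor_det_det, det_comp_det]
  rfl

theorem hexagon' (X Y Z : Sys FinSet) :
    comp (det (Sys.assocEquiv X Y Z).symm)
        (comp (det (Sys.swapEquiv (.tensor X Y) Z)) (det (Sys.assocEquiv Z X Y).symm)) =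
      comp (tensor (det (X := X) (Y := X) id) (det (Sys.swapEquiv Y Z)))
        (comp (det (Sys.assocEquiv X Z Y).symm)
          (tensor (det (Sys.swapEquiv X Z)) (det (X := Y) (Y := Y) id))) := by
  simp only [tensor_det_det, det_comp_det]
  rfl

theorem swap_swap (X Y : Sys FinSet) :
    comp (det (Sys.swapEquiv X Y)) (det (Sys.swapEquiv Y X)) = det id := by
  rw [det_comp_det]
  rfl

instance : MonoidalCategory SubStoch :=
  MonoidalCategory.ofTensorHom
    (id_tensorHom_id := fun _ _ => tensor_det_det _ _)
    (id_tensorHom := fun _ _ _ _ => rfl)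
    (tensorHom_id := fun _ _ => rfl)
    (tensorHom_comp_tensorHom := fun _ _ _ _ => tensor_comp_tensor _ _ _ _)
    (associator_naturality := fun f₁ f₂ f₃ => assoc_nat f₁ f₂ f₃)
    (leftUnitor_naturality := fun f => lunit_nat f)
    (rightUnitor_naturality := fun f => runit_nat f)
    (pentagon := pentagon)
    (triangle := triangle)

instance : SymmetricCategory SubStoch where
  braiding X Y := detIso (Sys.swapEquiv X Y)
  braiding_naturality_right X {_ _} f := swap_nat (det (X := X) (Y := X) id) f
  braiding_naturality_left {_ _} f Z := swap_nat f (det (X := Z) (Y := Z) id)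
  hexagon_forward := hexagon
  hexagon_reverse := hexagon'
  symmetry := swap_swap

/-- The point distribution `[x]`. -/
def point {X : Sys FinSet} (x : X.Val) : Hom .unit X := det fun _ => x

/-- Marginalisation over `X`, which is also the tautological propositional effect on `X`. -/
def discard (X : Sys FinSet) : Hom X .unit := det fun _ => ()

/-- The broadcasting map, `[x] ↦ [x] ⊗ [x]`. -/
def copy (X : Sys FinSet) : Hom X (.tensor X X) := det fun x => (x, x)

/-- The propagation of knowledge about the state of `A` and about the dynamics from `A` to `B` to
knowledge about the state of `B`: `[a] ⊗ [f] ↦ [f a]`. -/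
def propagate (A B : Sys FinSet) : Hom (.tensor A (funcSys A B)) B :=
  det fun p : A.Val × Func A B => p.2 p.1

/-- From knowledge about two successive dynamics to knowledge about their sequential composite:
`[f] ⊗ [g] ↦ [g ∘ f]`. -/
def seqComp (A B C : Sys FinSet) :
    Hom (.tensor (funcSys A B) (funcSys B C)) (funcSys A C) :=
  det fun p : Func A B × Func B C => p.2 ∘ p.1

/-- From knowledge about two causally disconnected dynamics to knowledge about their parallel
composite: `[f] ⊗ [g] ↦ [f × g]`. -/
def parComp (A B C D : Sys FinSet) :
    Hom (.tensor (funcSys A B) (funcSys C D)) (funcSys (.tensor A C) (.tensor B D)) :=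
  det fun p : Func A B × Func C D => Sys.prodMap p.1 p.2

end SubStoch

/-! ### The classical realist causal-inferential theory -/

/-- The elementary systems: causal or inferential, each labelled by a finite set. -/
inductive Wire : Type 1
  | causal (a : FinSet)
  | inferential (a : FinSet)

/-- The label of the wire is inferential. -/
def Wire.IsInferential : Wire → Prop
  | .causal _ => False
  | .inferential _ => True

/-- The systems of the classical realist causal-inferential theory `F-S`. -/
abbrev FS : Type 1 := Sys Wire

/-- A system of `Func`, as a causal system of `F-S`. -/
abbrev caus (A : Sys FinSet) : Sys Wire := A.map Wire.causal

/-- A system of `SubStoch`, as an inferential system of `F-S`. -/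
abbrev inf (X : Sys FinSet) : Sys Wire := X.map Wire.inferential

/-- Formal diagrams of `F-S`: sequential and parallel composites of the bare wirings (identities,
rebracketings, insertion and removal of the trivial system, swaps), of the substochastic maps, and
of the three generators that let causal and inferential systems interact. -/
inductive Diagram : Sys Wire → Sys Wire → Type 1
  | ident (a : Sys Wire) : Diagram a a
  | comp {a b c : Sys Wire} (f : Diagram a b) (g : Diagram b c) : Diagram a c
  | tensor {a b a' b' : Sys Wire} (f : Diagram a b) (g : Diagram a' b') :
      Diagram (.tensor a a') (.tensor b b')
  | assoc (a b c : Sys Wire) : Diagram (.tensor (.tensor a b) c) (.tensor a (.tensor b c))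
  | assocInv (a b c : Sys Wire) : Diagram (.tensor a (.tensor b c)) (.tensor (.tensor a b) c)
  | lunit (a : Sys Wire) : Diagram (.tensor .unit a) a
  | lunitInv (a : Sys Wire) : Diagram a (.tensor .unit a)
  | runit (a : Sys Wire) : Diagram (.tensor a .unit) a
  | runitInv (a : Sys Wire) : Diagram a (.tensor a .unit)
  | swap (a b : Sys Wire) : Diagram (.tensor a b) (.tensor b a)
  /-- A substochastic map. -/
  | infer {X Y : Sys FinSet} (s : SubStoch.Hom X Y) : Diagram (inf X) (inf Y)
  /-- Specification of the state of knowledge about the dynamics from `A` to `B`. -/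
  | know (A B : Sys FinSet) : Diagram (.tensor (caus A) (inf (funcSys A B))) (caus B)
  /-- Gaining knowledge about the ontic state of `A` (attaching propositions to `A`). -/
  | learn (A : Sys FinSet) : Diagram (caus A) (.tensor (caus A) (inf A))
  /-- Ignoring the causal system `A`. -/
  | ignore (A : Sys FinSet) : Diagram (caus A) .unit

namespace Diagram

/-- Sequential composition, in diagrammatic order. -/
infixr:80 " ⨟ " => Diagram.comp

/-- Parallel composition. -/
infixr:81 " ⊠ " => Diagram.tensor

/-- The wiring that exchanges the two middle systems. -/
def mid (a b c d : Sys Wire) :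
    Diagram (.tensor (.tensor a b) (.tensor c d)) (.tensor (.tensor a c) (.tensor b d)) :=
  assoc a b (.tensor c d) ⨟ (ident a ⊠ assocInv b c d) ⨟ (ident a ⊠ (swap b c ⊠ ident d)) ⨟
    (ident a ⊠ assoc c b d) ⨟ assocInv a c (.tensor b d)

/-- The embedding of a function into `F-S`: the point distribution `[f]` as the state of knowledge
about the dynamics. -/
def embed {A B : Sys FinSet} (f : Func A B) : Diagram (caus A) (caus B) :=
  runitInv (caus A) ⨟ (ident (caus A) ⊠ infer (SubStoch.point (X := funcSys A B) f)) ⨟ know A B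

end Diagram

open Diagram in
/-- Equality of diagrams of `F-S`: the congruence generated by the rewrite rules. -/
inductive Rewrites : {a b : Sys Wire} → Diagram a b → Diagram a b → Prop
  -- congruence
  | refl {a b} (f : Diagram a b) : Rewrites f f
  | symm {a b} {f g : Diagram a b} : Rewrites f g → Rewrites g f
  | trans {a b} {f g h : Diagram a b} : Rewrites f g → Rewrites g h → Rewrites f h
  | comp_congr {a b c} {f f' : Diagram a b} {g g' : Diagram b c} :
      Rewrites f f' → Rewrites g g' → Rewrites (f ⨟ g) (f' ⨟ g')
  | tensor_congr {a b a' b'} {f f' : Diagram a b} {g g' : Diagram a' b'} :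
      Rewrites f f' → Rewrites g g' → Rewrites (f ⊠ g) (f' ⊠ g')
  -- only the connectivity matters: the laws of symmetric monoidal categories
  | id_comp {a b} (f : Diagram a b) : Rewrites (ident a ⨟ f) f
  | comp_id {a b} (f : Diagram a b) : Rewrites (f ⨟ ident b) f
  | comp_assoc {a b c d} (f : Diagram a b) (g : Diagram b c) (h : Diagram c d) :
      Rewrites ((f ⨟ g) ⨟ h) (f ⨟ g ⨟ h)
  | id_tensor_id (a b) : Rewrites (ident a ⊠ ident b) (ident (.tensor a b))
  | tensor_comp {a b c a' b' c'} (f : Diagram a b) (f' : Diagram a' b') (g : Diagram b c)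
      (g' : Diagram b' c') : Rewrites ((f ⊠ f') ⨟ (g ⊠ g')) ((f ⨟ g) ⊠ (f' ⨟ g'))
  | assoc_hom_inv (a b c) : Rewrites (assoc a b c ⨟ assocInv a b c) (ident _)
  | assoc_inv_hom (a b c) : Rewrites (assocInv a b c ⨟ assoc a b c) (ident _)
  | lunit_hom_inv (a) : Rewrites (lunit a ⨟ lunitInv a) (ident _)
  | lunit_inv_hom (a) : Rewrites (lunitInv a ⨟ lunit a) (ident _)
  | runit_hom_inv (a) : Rewrites (runit a ⨟ runitInv a) (ident _)
  | runit_inv_hom (a) : Rewrites (runitInv a ⨟ runit a) (ident _)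
  | swap_swap (a b) : Rewrites (swap a b ⨟ swap b a) (ident _)
  | assoc_nat {a b c a' b' c'} (f : Diagram a a') (g : Diagram b b') (h : Diagram c c') :
      Rewrites (((f ⊠ g) ⊠ h) ⨟ assoc a' b' c') (assoc a b c ⨟ (f ⊠ (g ⊠ h)))
  | lunit_nat {a b} (f : Diagram a b) : Rewrites ((ident .unit ⊠ f) ⨟ lunit b) (lunit a ⨟ f)
  | runit_nat {a b} (f : Diagram a b) : Rewrites ((f ⊠ ident .unit) ⨟ runit b) (runit a ⨟ f)
  | swap_nat {a b a' b'} (f : Diagram a a') (g : Diagram b b') :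
      Rewrites ((f ⊠ g) ⨟ swap a' b') (swap a b ⨟ (g ⊠ f))
  | pentagon (a b c d) :
      Rewrites ((assoc a b c ⊠ ident d) ⨟ assoc a (.tensor b c) d ⨟ (ident a ⊠ assoc b c d))
        (assoc (.tensor a b) c d ⨟ assoc a b (.tensor c d))
  | triangle (a b) : Rewrites (assoc a .unit b ⨟ (ident a ⊠ lunit b)) (runit a ⊠ ident b)
  | hexagon (a b c) :
      Rewrites (assoc a b c ⨟ swap a (.tensor b c) ⨟ assoc b c a)
        ((swap a b ⊠ ident c) ⨟ assoc b a c ⨟ (ident b ⊠ swap a c))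
  -- the substochastic maps form a subtheory
  | infer_id (X) : Rewrites (infer (SubStoch.det (X := X) (Y := X) id)) (ident (inf X))
  | infer_comp {X Y Z} (s : SubStoch.Hom X Y) (t : SubStoch.Hom Y Z) :
      Rewrites (infer (SubStoch.comp s t)) (infer s ⨟ infer t)
  | infer_tensor {X Y X' Y'} (s : SubStoch.Hom X Y) (t : SubStoch.Hom X' Y') :
      Rewrites (infer (SubStoch.tensor s t)) (infer s ⊠ infer t)
  | infer_assoc (X Y Z) :
      Rewrites (infer (SubStoch.det (Sys.assocEquiv X Y Z))) (assoc (inf X) (inf Y) (inf Z))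
  | infer_lunit (X) : Rewrites (infer (SubStoch.det (Sys.lunitEquiv X))) (lunit (inf X))
  | infer_runit (X) : Rewrites (infer (SubStoch.det (Sys.runitEquiv X))) (runit (inf X))
  | infer_swap (X Y) :
      Rewrites (infer (SubStoch.det (Sys.swapEquiv X Y))) (swap (inf X) (inf Y))
  -- knowledge about sequential and parallel composites of dynamics
  | know_comp (A B C : Sys FinSet) :
      Rewrites ((know A B ⊠ ident (inf (funcSys B C))) ⨟ know B C)
        (assoc (caus A) (inf (funcSys A B)) (inf (funcSys B C)) ⨟
          (ident (caus A) ⊠ infer (SubStoch.seqComp A B C)) ⨟ know A C)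
  | know_tensor (A B C D : Sys FinSet) :
      Rewrites (know A B ⊠ know C D)
        (mid (caus A) (inf (funcSys A B)) (caus C) (inf (funcSys C D)) ⨟
          (ident (caus (.tensor A C)) ⊠ infer (SubStoch.parComp A B C D)) ⨟
          know (.tensor A C) (.tensor B D))
  -- certainty that the dynamics is a bare wiring is that wiring
  | embed_id (A : Sys FinSet) : Rewrites (embed (A := A) (B := A) id) (ident (caus A))
  | embed_swap (A B) : Rewrites (embed (Sys.swapEquiv A B)) (swap (caus A) (caus B))
  | embed_assoc (A B C) :
      Rewrites (embed (Sys.assocEquiv A B C)) (assoc (caus A) (caus B) (caus C))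
  | embed_lunit (A) : Rewrites (embed (Sys.lunitEquiv A)) (lunit (caus A))
  | embed_runit (A) : Rewrites (embed (Sys.runitEquiv A)) (runit (caus A))
  -- asking the tautological question is asking nothing
  | learn_discard (A : Sys FinSet) :
      Rewrites (learn A ⨟ (ident (caus A) ⊠ infer (SubStoch.discard A)) ⨟ runit (caus A))
        (ident (caus A))
  -- learning twice is copying what is learnt
  | learn_learn (A : Sys FinSet) :
      Rewrites (learn A ⨟ (learn A ⊠ ident (inf A)) ⨟ assoc (caus A) (inf A) (inf A))
        (learn A ⨟ (ident (caus A) ⊠ infer (SubStoch.copy A)))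
  -- learning about a composite system is learning about each component
  | learn_tensor (A B : Sys FinSet) :
      Rewrites (learn (.tensor A B))
        ((learn A ⊠ learn B) ⨟ mid (caus A) (inf A) (caus B) (inf B))
  -- ignoring
  | ignore_unit : Rewrites (ignore .unit) (ident .unit)
  | ignore_tensor (A B : Sys FinSet) :
      Rewrites (ignore (.tensor A B)) ((ignore A ⊠ ignore B) ⨟ lunit .unit)
  | know_ignore (A B : Sys FinSet) :
      Rewrites (know A B ⨟ ignore B)
        ((ignore A ⊠ infer (SubStoch.discard (funcSys A B))) ⨟ lunit .unit)
  -- knowledge about the output of the dynamics is knowledge about the input and about the dynamics,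
  -- propagated
  | know_learn (A B : Sys FinSet) :
      Rewrites (know A B ⨟ learn B)
        ((learn A ⊠ infer (SubStoch.copy (funcSys A B))) ⨟
          mid (caus A) (inf A) (inf (funcSys A B)) (inf (funcSys A B)) ⨟
          (know A B ⊠ infer (SubStoch.propagate A B)))

namespace FS

/-- Equality of diagrams as a setoid. -/
instance diagramSetoid (a b : Sys Wire) : Setoid (Diagram a b) where
  r := Rewrites
  iseqv := ⟨.refl, .symm, .trans⟩

/-- The processes of `F-S`: diagrams up to the rewrite rules. -/
instance : Category FS where
  Hom a b := Quotient (diagramSetoid a b)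
  id a := ⟦Diagram.ident a⟧
  comp := Quotient.map₂ Diagram.comp fun _ _ h _ _ h' => Rewrites.comp_congr h h'
  id_comp := by rintro _ _ ⟨f⟩; exact Quotient.sound (.id_comp f)
  comp_id := by rintro _ _ ⟨f⟩; exact Quotient.sound (.comp_id f)
  assoc := by rintro _ _ _ _ ⟨f⟩ ⟨g⟩ ⟨h⟩; exact Quotient.sound (.comp_assoc f g h)

/-- The process of `F-S` described by a diagram. -/
def mk {a b : FS} (f : Diagram a b) : a ⟶ b := Quotient.mk (diagramSetoid a b) f

/-- Parallel composition of processes of `F-S`. -/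
def tensorMap {a b a' b' : FS} (f : a ⟶ b) (g : a' ⟶ b') :
    @Quiver.Hom FS _ (Sys.tensor a a') (Sys.tensor b b') :=
  Quotient.map₂ Diagram.tensor (fun _ _ h _ _ h' => Rewrites.tensor_congr h h') f g

instance : MonoidalCategoryStruct FS where
  tensorObj a b := Sys.tensor a b
  tensorUnit := Sys.unit
  tensorHom f g := tensorMap f g
  whiskerLeft a _ _ f := tensorMap (𝟙 a) f
  whiskerRight f a := tensorMap f (𝟙 a)
  associator a b c :=
    { hom := mk (.assoc a b c)
      inv := mk (.assocInv a b c)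
      hom_inv_id := Quotient.sound (.assoc_hom_inv a b c)
      inv_hom_id := Quotient.sound (.assoc_inv_hom a b c) }
  leftUnitor a :=
    { hom := mk (.lunit a)
      inv := mk (.lunitInv a)
      hom_inv_id := Quotient.sound (.lunit_hom_inv a)
      inv_hom_id := Quotient.sound (.lunit_inv_hom a) }
  rightUnitor a :=
    { hom := mk (.runit a)
      inv := mk (.runitInv a)
      hom_inv_id := Quotient.sound (.runit_hom_inv a)
      inv_hom_id := Quotient.sound (.runit_inv_hom a) }

instance : MonoidalCategory FS :=
  MonoidalCategory.ofTensorHom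
    (id_tensorHom_id := fun a b => Quotient.sound (.id_tensor_id a b))
    (id_tensorHom := fun _ _ _ _ => rfl)
    (tensorHom_id := fun _ _ => rfl)
    (tensorHom_comp_tensorHom := by
      rintro _ _ _ _ _ _ ⟨f⟩ ⟨f'⟩ ⟨g⟩ ⟨g'⟩
      exact Quotient.sound (.tensor_comp f f' g g'))
    (associator_naturality := by
      rintro _ _ _ _ _ _ ⟨f⟩ ⟨g⟩ ⟨h⟩
      exact Quotient.sound (.assoc_nat f g h))
    (leftUnitor_naturality := by rintro _ _ ⟨f⟩; exact Quotient.sound (.lunit_nat f))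
    (rightUnitor_naturality := by rintro _ _ ⟨f⟩; exact Quotient.sound (.runit_nat f))
    (pentagon := fun a b c d => Quotient.sound (.pentagon a b c d))
    (triangle := fun a b => Quotient.sound (.triangle a b))

/-- The swap of two systems of `F-S`. -/
def swapIso (a b : FS) : a ⊗ b ≅ b ⊗ a where
  hom := mk (.swap a b)
  inv := mk (.swap b a)
  hom_inv_id := Quotient.sound (.swap_swap a b)
  inv_hom_id := Quotient.sound (.swap_swap b a)

theorem swap_hexagon (a b c : FS) :
    (α_ a b c).hom ≫ (swapIso a (b ⊗ c)).hom ≫ (α_ b c a).hom =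
      ((swapIso a b).hom ▷ c) ≫ (α_ b a c).hom ≫ (b ◁ (swapIso a c).hom) :=
  Quotient.sound (.hexagon a b c)

instance : SymmetricCategory FS where
  braiding := swapIso
  braiding_naturality_right := by
    rintro a _ _ ⟨f⟩
    exact Quotient.sound (.swap_nat (.ident _) f)
  braiding_naturality_left := by
    rintro _ _ ⟨f⟩ c
    exact Quotient.sound (.swap_nat f (.ident _))
  hexagon_forward := swap_hexagon
  hexagon_reverse a b c := by
    have h : inv ((α_ c a b).hom ≫ (swapIso c (a ⊗ b)).hom ≫ (α_ a b c).hom) =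
        inv (((swapIso c a).hom ▷ b) ≫ (α_ a c b).hom ≫ (a ◁ (swapIso c b).hom)) := by
      simp only [swap_hexagon c a b]
    simp only [IsIso.inv_comp, IsIso.Iso.inv_hom, inv_whiskerLeft, inv_whiskerRight,
      Category.assoc] at h
    exact h
  symmetry a b := Quotient.sound (.swap_swap a b)

/-- A system of `F-S` is causally closed when all of its wires are inferential. -/
def causallyClosed : ObjectProperty FS := fun a => Sys.All Wire.IsInferential a

instance : causallyClosed.IsMonoidal where
  prop_unit := trivial
  prop_tensor _ _ h h' := ⟨h, h'⟩

end FS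

theorem causallyClosed_inf (X : Sys FinSet) : FS.causallyClosed (inf X) := by
  induction X with
  | unit => trivial
  | wire a => trivial
  | tensor X Y hX hY => exact ⟨hX, hY⟩

/-- The sub-process-theory of causally closed processes of `F-S`: all processes of `F-S` whose
inputs and outputs are inferential only (the causal systems may occur inside). -/
abbrev ClosedFS : Type 1 := FS.causallyClosed.FullSubcategory

/-- The inclusion of `SubStoch` into `F-S`. -/
def inclusion : SubStoch ⥤ FS where
  obj X := inf X
  map s := FS.mk (.infer s)
  map_id X := Quotient.sound (.infer_id X)
  map_comp s t := Quotient.sound (.infer_comp s t)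

/-- The inclusion of `SubStoch` into `F-S`, with values in the causally closed processes. -/
def closedInclusion : SubStoch ⥤ ClosedFS :=
  FS.causallyClosed.lift inclusion causallyClosed_inf

/-- A functor between symmetric monoidal categories is diagram-preserving if it preserves
diagrams on the nose, i.e. if it is a strict symmetric monoidal functor. -/
structure DiagramPreserving {C D : Type*} [Category C] [MonoidalCategory C] [SymmetricCategory C]
    [Category D] [MonoidalCategory D] [SymmetricCategory D] (F : C ⥤ D) : Prop where
  obj_unit : F.obj (𝟙_ C) = 𝟙_ D
  obj_tensor (X Y : C) : F.obj (X ⊗ Y) = F.obj X ⊗ F.obj Y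
  map_tensor {X Y X' Y' : C} (f : X ⟶ Y) (g : X' ⟶ Y') :
    F.map (f ⊗ₘ g) =
      eqToHom (obj_tensor X X') ≫ (F.map f ⊗ₘ F.map g) ≫ eqToHom (obj_tensor Y Y').symm
  map_associator (X Y Z : C) :
    F.map (α_ X Y Z).hom =
      eqToHom (by rw [obj_tensor, obj_tensor]) ≫ (α_ (F.obj X) (F.obj Y) (F.obj Z)).hom ≫
        eqToHom (by rw [obj_tensor, obj_tensor])
  map_leftUnitor (X : C) :
    F.map (λ_ X).hom = eqToHom (by rw [obj_tensor, obj_unit]) ≫ (λ_ (F.obj X)).hom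
  map_rightUnitor (X : C) :
    F.map (ρ_ X).hom = eqToHom (by rw [obj_tensor, obj_unit]) ≫ (ρ_ (F.obj X)).hom
  map_braiding (X Y : C) :
    F.map (β_ X Y).hom =
      eqToHom (obj_tensor X Y) ≫ (β_ (F.obj X) (F.obj Y)).hom ≫ eqToHom (obj_tensor Y X).symm

/-- A prediction map: a partial diagram-preserving map from `F-S` to `SubStoch`, defined on the
causally closed processes, that is a left inverse of the inclusion of `SubStoch`. -/
structure IsPredictionMap (p : ClosedFS ⥤ SubStoch) : Prop where
  diagramPreserving : DiagramPreserving p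
  left_inverse : closedInclusion ⋙ p = 𝟭 SubStoch

end CausalInferential

end

/-! The causal/inferential distinction can be erased. Reading every causal wire as an inferential
wire with the same label, specification of dynamics as propagation, learning as copying and ignoring
as marginalisation turns each diagram into a substochastic map, `Diagram.eval`. Each rewrite rule
becomes a true equation of matrices (`Diagram.eval_eq_of_rewrites`), so evaluation descends to a
functor on all of `F-S`. Its restriction `predict` to causally closed processes is strictly
symmetric monoidal and a left inverse of `closedInclusion`. This gives existence.

For uniqueness, `predict` is shown to be a two-sided inverse of `closedInclusion`: the rewrite rules
suffice to reduce every causally closed diagram to a single substochastic map. The device is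
`prepare A`, which turns an inferential wire into a causal one by inserting the constant function
from the trivial system as the dynamics. The rules push such preparations through every generator:
`prepare_know` (propagation), `prepare_learn` (copying), `prepare_ignore` (marginalisation), and
`prepare_tensor` for composite systems. Preparing exactly the causal wires of a system,
`prepareCausal`, is then natural: `prepareCausal a ≫ f = infer (eval f) ≫ prepareCausal b`. A
causally closed system has nothing to prepare, so there both components are identities up to an
equality of objects, and `f` equals its evaluation. A left inverse of an invertible functor is its
inverse, hence every prediction map is `predict`. -/

noncomputable section

namespace CausalInferential

/-! ### Erasing the causal/inferential distinction and evaluating diagrams. -/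

/-- The finite set labelling a wire. -/
def Wire.label : Wire → FinSet
  | .causal a => a
  | .inferential a => a

/-- The system of finite sets obtained by forgetting which wires are causal and which are
inferential. -/
abbrev erase (a : Sys Wire) : Sys FinSet := a.map Wire.label

theorem erase_caus (A : Sys FinSet) : erase (caus A) = A := by
  induction A with
  | unit => rfl
  | wire a => rfl
  | tensor X Y hX hY => exact congrArg₂ Sys.tensor hX hY

theorem erase_inf (X : Sys FinSet) : erase (inf X) = X := by
  induction X with
  | unit => rfl
  | wire a => rfl
  | tensor X Y hX hY => exact congrArg₂ Sys.tensor hX hY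

namespace SubStoch

/-- Transport of a substochastic map along equalities of systems. -/
def castHom {X X' Y Y' : Sys FinSet} (h : X' = X) (h' : Y' = Y) (s : Hom X Y) : Hom X' Y' :=
  match h, h' with
  | rfl, rfl => s

theorem castHom_eq {X X' Y Y' : SubStoch} (h : X' = X) (h' : Y' = Y) (s : X ⟶ Y) :
    castHom h h' s = eqToHom h ≫ s ≫ eqToHom h'.symm := by
  subst h h'
  simp only [eqToHom_refl, Category.id_comp, Category.comp_id]
  rfl

/-- The exchange of the two middle factors of a fourfold product. -/
def midEquiv (A B C D : Sys FinSet) :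
    Sys.Val (.tensor (.tensor A B) (.tensor C D)) ≃
      Sys.Val (.tensor (.tensor A C) (.tensor B D)) :=
  Equiv.prodProdProdComm A.Val B.Val C.Val D.Val

end SubStoch

open SubStoch

/-- The substochastic map described by a diagram when causal systems are read as inferential ones:
dynamics are propagated, learning is copying, ignoring is marginalising. -/
def Diagram.eval : {a b : Sys Wire} → Diagram a b → Hom (erase a) (erase b)
  | _, _, .ident _ => det id
  | _, _, .comp f g => SubStoch.comp f.eval g.eval
  | _, _, .tensor f g => SubStoch.tensor f.eval g.eval
  | _, _, .assoc a b c => det (Sys.assocEquiv (erase a) (erase b) (erase c))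
  | _, _, .assocInv a b c => det (Sys.assocEquiv (erase a) (erase b) (erase c)).symm
  | _, _, .lunit a => det (Sys.lunitEquiv (erase a))
  | _, _, .lunitInv a => det (Sys.lunitEquiv (erase a)).symm
  | _, _, .runit a => det (Sys.runitEquiv (erase a))
  | _, _, .runitInv a => det (Sys.runitEquiv (erase a)).symm
  | _, _, .swap a b => det (Sys.swapEquiv (erase a) (erase b))
  | _, _, .infer s => castHom (erase_inf _) (erase_inf _) s
  | _, _, .know A B =>
      castHom (congrArg₂ Sys.tensor (erase_caus A) (erase_inf (funcSys A B))) (erase_caus B)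
        (propagate A B)
  | _, _, .learn A =>
      castHom (erase_caus A) (congrArg₂ Sys.tensor (erase_caus A) (erase_inf A)) (copy A)
  | _, _, .ignore A => castHom (erase_caus A) rfl (discard A)

/-! ### Soundness of evaluation for the rewrite rules. -/

theorem Diagram.eval_mid (a b c d : Sys Wire) :
    (Diagram.mid a b c d).eval = det (midEquiv (erase a) (erase b) (erase c) (erase d)) := by
  simp only [Diagram.mid, Diagram.eval, tensor_det_det, det_comp_det]
  rfl

/-- For a variable system, `erase (caus A) = A` and `erase (inf X) = X` hold only by induction, so
the evaluated rules contain casts. This lemma and those like it below replace the erased systems by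
arbitrary `X'` with `X' = X`, so that `subst` removes the casts. What remains is either reflexive or
an equality of composites of deterministic maps, that is, of functions, which holds by computation.
Where `funcSys` occurs the cast is `rfl`, since erasure computes on a single wire. -/
theorem castHom_id {X X' : Sys FinSet} (hX : X' = X) :
    castHom hX hX (det id) = det id := by
  subst hX
  rfl

theorem castHom_comp {X X' Y Y' Z Z' : Sys FinSet} (hX : X' = X) (hY : Y' = Y) (hZ : Z' = Z)
    (s : Hom X Y) (t : Hom Y Z) :
    castHom hX hZ (SubStoch.comp s t) = SubStoch.comp (castHom hX hY s) (castHom hY hZ t) := by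
  subst hX hY hZ
  rfl

theorem castHom_tensor {X X' Y Y' Z Z' W W' : Sys FinSet} (hX : X' = X) (hY : Y' = Y)
    (hZ : Z' = Z) (hW : W' = W)
    (s : Hom X Y) (t : Hom Z W) :
    castHom (congrArg₂ Sys.tensor hX hZ) (congrArg₂ Sys.tensor hY hW) (SubStoch.tensor s t) =
      SubStoch.tensor (castHom hX hY s) (castHom hZ hW t) := by
  subst hX hY hZ hW
  rfl

theorem castHom_assoc {X X' Y Y' Z Z' : Sys FinSet} (hX : X' = X) (hY : Y' = Y) (hZ : Z' = Z) :
    castHom (congrArg₂ Sys.tensor (congrArg₂ Sys.tensor hX hY) hZ)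
      (congrArg₂ Sys.tensor hX (congrArg₂ Sys.tensor hY hZ)) (det (Sys.assocEquiv X Y Z)) =
      det (Sys.assocEquiv X' Y' Z') := by
  subst hX hY hZ
  rfl

theorem castHom_lunit {X X' : Sys FinSet} (hX : X' = X) :
    castHom (congrArg₂ Sys.tensor rfl hX) hX (det (Sys.lunitEquiv X)) =
      det (Sys.lunitEquiv X') := by
  subst hX
  rfl

theorem castHom_runit {X X' : Sys FinSet} (hX : X' = X) :
    castHom (congrArg₂ Sys.tensor hX rfl) hX (det (Sys.runitEquiv X)) =
      det (Sys.runitEquiv X') := by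
  subst hX
  rfl

theorem castHom_swap {X X' Y Y' : Sys FinSet} (hX : X' = X) (hY : Y' = Y) :
    castHom (congrArg₂ Sys.tensor hX hY) (congrArg₂ Sys.tensor hY hX) (det (Sys.swapEquiv X Y)) =
      det (Sys.swapEquiv X' Y') := by
  subst hX hY
  rfl

theorem castHom_know_comp {A A' B B' C C' : Sys FinSet} (hA : A' = A) (hB : B' = B) (hC : C' = C) :
    SubStoch.comp (SubStoch.tensor (castHom (congrArg₂ Sys.tensor hA rfl) hB (propagate A B))
      (det (X := funcSys B C) (Y := funcSys B C) id))
        (castHom (congrArg₂ Sys.tensor hB rfl) hC (propagate B C)) =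
      SubStoch.comp (det (Sys.assocEquiv A' (funcSys A B) (funcSys B C)))
        (SubStoch.comp (SubStoch.tensor (det (X := A') (Y := A') id) (seqComp A B C))
          (castHom (congrArg₂ Sys.tensor hA rfl) hC (propagate A C))) := by
  subst hA hB hC
  simp only [castHom, propagate, seqComp, tensor_det_det, det_comp_det]
  rfl

theorem castHom_know_tensor {A A' B B' C C' D D' : Sys FinSet} (hA : A' = A) (hB : B' = B)
    (hC : C' = C) (hD : D' = D) :
    SubStoch.tensor (castHom (congrArg₂ Sys.tensor hA rfl) hB (propagate A B))
      (castHom (congrArg₂ Sys.tensor hC rfl) hD (propagate C D)) =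
      SubStoch.comp (det (midEquiv A' (funcSys A B) C' (funcSys C D)))
        (SubStoch.comp (SubStoch.tensor (det (X := .tensor A' C') (Y := .tensor A' C') id)
          (parComp A B C D))
          (castHom (congrArg₂ Sys.tensor (congrArg₂ Sys.tensor hA hC) rfl)
            (congrArg₂ Sys.tensor hB hD) (propagate (.tensor A C) (.tensor B D)))) := by
  subst hA hB hC hD
  simp only [castHom, propagate, parComp, tensor_det_det, det_comp_det]
  rfl

/-- Propagating along a point distribution at `f` is applying `f`. The rules that identify embedded
wirings with bare wirings thereby reduce to the cast lemmas above. -/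
theorem comp_point_propagate {A A' B B' : Sys FinSet} (hA : A' = A) (hB : B' = B)
    (f : Func A B) :
    SubStoch.comp (det (Sys.runitEquiv A').symm)
        (SubStoch.comp (SubStoch.tensor (det (X := A') (Y := A') id) (point (X := funcSys A B) f))
          (castHom (congrArg₂ Sys.tensor hA rfl) hB (propagate A B))) =
      castHom hA hB (det f) := by
  subst hA hB
  simp only [castHom, propagate, point, tensor_det_det, det_comp_det]
  rfl

theorem Diagram.eval_embed {A B : Sys FinSet} (f : Func A B) :
    (Diagram.embed f).eval = castHom (erase_caus A) (erase_caus B) (det f) :=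
  comp_point_propagate (erase_caus A) (erase_caus B) f

/-- Two copies `A₁`, `A₂` of `A` are needed from here on: they stand for `erase (caus A)` and `erase
(inf A)`, which are equal but not syntactically so. -/
theorem castHom_learn_discard {A A₁ A₂ : Sys FinSet} (hA₁ : A₁ = A) (hA₂ : A₂ = A) :
    SubStoch.comp (castHom hA₁ (congrArg₂ Sys.tensor hA₁ hA₂) (copy A))
        (SubStoch.comp (SubStoch.tensor (det (X := A₁) (Y := A₁) id)
          (castHom hA₂ rfl (SubStoch.discard A)))
          (det (Sys.runitEquiv A₁))) = det id := by
  subst hA₁ hA₂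
  simp only [castHom, copy, SubStoch.discard, tensor_det_det, det_comp_det]
  rfl

theorem castHom_learn_learn {A A₁ A₂ : Sys FinSet} (hA₁ : A₁ = A) (hA₂ : A₂ = A) :
    SubStoch.comp (castHom hA₁ (congrArg₂ Sys.tensor hA₁ hA₂) (copy A))
        (SubStoch.comp (SubStoch.tensor (castHom hA₁ (congrArg₂ Sys.tensor hA₁ hA₂) (copy A))
          (det (X := A₂) (Y := A₂) id))
          (det (Sys.assocEquiv A₁ A₂ A₂))) =
      SubStoch.comp (castHom hA₁ (congrArg₂ Sys.tensor hA₁ hA₂) (copy A))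
        (SubStoch.tensor (det (X := A₁) (Y := A₁) id)
          (castHom hA₂ (congrArg₂ Sys.tensor hA₂ hA₂) (copy A))) := by
  subst hA₁ hA₂
  simp only [castHom, copy, tensor_det_det, det_comp_det]
  rfl

theorem castHom_learn_tensor {A A₁ A₂ B B₁ B₂ : Sys FinSet} (hA₁ : A₁ = A) (hA₂ : A₂ = A)
    (hB₁ : B₁ = B) (hB₂ : B₂ = B) :
    castHom (congrArg₂ Sys.tensor hA₁ hB₁) (congrArg₂ Sys.tensor (congrArg₂ Sys.tensor hA₁ hB₁)
      (congrArg₂ Sys.tensor hA₂ hB₂)) (copy (.tensor A B)) =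
      SubStoch.comp (SubStoch.tensor (castHom hA₁ (congrArg₂ Sys.tensor hA₁ hA₂) (copy A))
        (castHom hB₁ (congrArg₂ Sys.tensor hB₁ hB₂) (copy B)))
        (det (midEquiv A₁ A₂ B₁ B₂)) := by
  subst hA₁ hA₂ hB₁ hB₂
  simp only [castHom, copy, tensor_det_det, det_comp_det]
  rfl

theorem castHom_ignore_tensor {A A' B B' : Sys FinSet} (hA : A' = A) (hB : B' = B) :
    castHom (congrArg₂ Sys.tensor hA hB) rfl (SubStoch.discard (.tensor A B)) =
      SubStoch.comp (SubStoch.tensor (castHom hA rfl (SubStoch.discard A))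
        (castHom hB rfl (SubStoch.discard B))) (det (Sys.lunitEquiv .unit)) := by
  subst hA hB
  simp only [castHom, SubStoch.discard, tensor_det_det, det_comp_det]

theorem castHom_know_ignore {A A' B B' : Sys FinSet} (hA : A' = A) (hB : B' = B) :
    SubStoch.comp (castHom (congrArg₂ Sys.tensor hA rfl) hB (propagate A B))
      (castHom hB rfl (SubStoch.discard B)) =
      SubStoch.comp (SubStoch.tensor (castHom hA rfl (SubStoch.discard A))
        (SubStoch.discard (funcSys A B))) (det (Sys.lunitEquiv .unit)) := by
  subst hA hB
  simp only [castHom, propagate, SubStoch.discard, tensor_det_det, det_comp_det]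
  rfl

theorem castHom_know_learn {A A₁ A₂ B B₁ B₂ : Sys FinSet} (hA₁ : A₁ = A) (hA₂ : A₂ = A) (hB₁ : B₁ = B)
    (hB₂ : B₂ = B) :
    SubStoch.comp (castHom (congrArg₂ Sys.tensor hA₁ rfl) hB₁ (propagate A B))
      (castHom hB₁ (congrArg₂ Sys.tensor hB₁ hB₂) (copy B)) =
      SubStoch.comp (SubStoch.tensor (castHom hA₁ (congrArg₂ Sys.tensor hA₁ hA₂) (copy A))
        (copy (funcSys A B)))
        (SubStoch.comp (det (midEquiv A₁ A₂ (funcSys A B) (funcSys A B)))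
          (SubStoch.tensor (castHom (congrArg₂ Sys.tensor hA₁ rfl) hB₁ (propagate A B))
            (castHom (congrArg₂ Sys.tensor hA₂ rfl) hB₂ (propagate A B)))) := by
  subst hA₁ hA₂ hB₁ hB₂
  simp only [castHom, copy, propagate, tensor_det_det, det_comp_det]
  rfl

theorem Diagram.eval_eq_of_rewrites {a b : Sys Wire} {f g : Diagram a b} (h : Rewrites f g) :
    f.eval = g.eval := by
  induction h with
  | refl f => rfl
  | symm _ ih => exact ih.symm
  | trans _ _ ih ih' => exact ih.trans ih'
  | comp_congr _ _ ih ih' => exact congrArg₂ SubStoch.comp ih ih'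
  | tensor_congr _ _ ih ih' => exact congrArg₂ SubStoch.tensor ih ih'
  | id_comp f => exact det_id_comp _
  | comp_id f => exact comp_det_id _
  | comp_assoc f g h => exact SubStoch.comp_assoc _ _ _
  | id_tensor_id a b => exact tensor_det_det _ _
  | tensor_comp f f' g g' => exact tensor_comp_tensor _ _ _ _
  | assoc_hom_inv a b c => exact (SubStoch.detIso (Sys.assocEquiv _ _ _)).hom_inv_id
  | assoc_inv_hom a b c => exact (SubStoch.detIso (Sys.assocEquiv _ _ _)).inv_hom_id
  | lunit_hom_inv a => exact (SubStoch.detIso (Sys.lunitEquiv _)).hom_inv_id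
  | lunit_inv_hom a => exact (SubStoch.detIso (Sys.lunitEquiv _)).inv_hom_id
  | runit_hom_inv a => exact (SubStoch.detIso (Sys.runitEquiv _)).hom_inv_id
  | runit_inv_hom a => exact (SubStoch.detIso (Sys.runitEquiv _)).inv_hom_id
  | swap_swap a b => exact SubStoch.swap_swap _ _
  | assoc_nat f g h => exact SubStoch.assoc_nat _ _ _
  | lunit_nat f => exact SubStoch.lunit_nat _
  | runit_nat f => exact SubStoch.runit_nat _
  | swap_nat f g => exact SubStoch.swap_nat _ _
  | pentagon a b c d => exact SubStoch.pentagon _ _ _ _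
  | triangle a b => exact SubStoch.triangle _ _
  | hexagon a b c => exact SubStoch.hexagon _ _ _
  | infer_id X =>
    exact castHom_id (erase_inf X)
  | @infer_comp X Y Z s t =>
    exact castHom_comp (erase_inf X) (erase_inf Y) (erase_inf Z) _ _
  | @infer_tensor X Y Z W s t =>
    exact castHom_tensor (erase_inf X) (erase_inf Y) (erase_inf Z) (erase_inf W) _ _
  | infer_assoc X Y Z =>
    exact castHom_assoc (erase_inf X) (erase_inf Y) (erase_inf Z)
  | infer_lunit X =>
    exact castHom_lunit (erase_inf X)
  | infer_runit X =>
    exact castHom_runit (erase_inf X)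
  | infer_swap X Y =>
    exact castHom_swap (erase_inf X) (erase_inf Y)
  | know_comp A B C =>
    exact castHom_know_comp (erase_caus A) (erase_caus B) (erase_caus C)
  | know_tensor A B C D =>
    rw [Diagram.eval, Diagram.eval, Diagram.eval_mid]
    exact castHom_know_tensor (erase_caus A) (erase_caus B) (erase_caus C) (erase_caus D)
  | embed_id A => exact (Diagram.eval_embed _).trans (castHom_id (erase_caus A))
  | embed_swap A B =>
    exact (Diagram.eval_embed _).trans (castHom_swap (erase_caus A) (erase_caus B))
  | embed_assoc A B C =>
    exact (Diagram.eval_embed _).trans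
      (castHom_assoc (erase_caus A) (erase_caus B) (erase_caus C))
  | embed_lunit A => exact (Diagram.eval_embed _).trans (castHom_lunit (erase_caus A))
  | embed_runit A => exact (Diagram.eval_embed _).trans (castHom_runit (erase_caus A))
  | learn_discard A =>
    exact castHom_learn_discard (erase_caus A) (erase_inf A)
  | learn_learn A =>
    exact castHom_learn_learn (erase_caus A) (erase_inf A)
  | learn_tensor A B =>
    rw [Diagram.eval, Diagram.eval, Diagram.eval_mid]
    exact castHom_learn_tensor (erase_caus A) (erase_inf A) (erase_caus B) (erase_inf B)
  | ignore_unit => rfl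
  | ignore_tensor A B =>
    exact castHom_ignore_tensor (erase_caus A) (erase_caus B)
  | know_ignore A B =>
    exact castHom_know_ignore (erase_caus A) (erase_caus B)
  | know_learn A B =>
    rw [Diagram.eval, Diagram.eval, Diagram.eval, Diagram.eval, Diagram.eval_mid]
    exact castHom_know_learn (erase_caus A) (erase_inf A) (erase_caus B) (erase_inf B)

/-! ### Existence: the evaluation functor restricted to causally closed processes. -/

/-- Reading causal systems as inferential ones, as a functor. -/
def evalFunctor : FS ⥤ SubStoch where
  obj a := erase a
  map f := Quotient.lift Diagram.eval (fun _ _ h => Diagram.eval_eq_of_rewrites h) f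
  map_id _ := rfl
  map_comp := by rintro _ _ _ ⟨f⟩ ⟨g⟩; rfl

/-- The substochastic map described by a causally closed process. -/
def predict : ClosedFS ⥤ SubStoch := FS.causallyClosed.ι ⋙ evalFunctor

/-- Erasure commutes with `tensor` and `unit` definitionally, so every `eqToHom` in
`DiagramPreserving predict` is taken along an equation that unfolds to `X = X`. Stating the
hypotheses in that form lets unification discard them. -/
theorem eq_eqToHom_comp_comp_eqToHom {C : Type*} [Category C] {X Y : C} {f g : X ⟶ Y} (h : f = g)
    (hX : X = X) (hY : Y = Y) : f = eqToHom hX ≫ g ≫ eqToHom hY := by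
  simpa using h

theorem eq_eqToHom_comp {C : Type*} [Category C] {X Y : C} {f g : X ⟶ Y} (h : f = g)
    (hX : X = X) : f = eqToHom hX ≫ g := by
  simpa using h

theorem predict_diagramPreserving : DiagramPreserving predict where
  obj_unit := rfl
  obj_tensor _ _ := rfl
  map_tensor := by
    rintro X Y X' Y' ⟨⟨f⟩⟩ ⟨⟨g⟩⟩
    exact eq_eqToHom_comp_comp_eqToHom (C := SubStoch) rfl rfl rfl
  map_associator _ _ _ := eq_eqToHom_comp_comp_eqToHom (C := SubStoch) rfl rfl rfl
  map_leftUnitor _ := eq_eqToHom_comp (C := SubStoch) rfl rfl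
  map_rightUnitor _ := eq_eqToHom_comp (C := SubStoch) rfl rfl
  map_braiding _ _ := eq_eqToHom_comp_comp_eqToHom (C := SubStoch) rfl rfl rfl

theorem closedInclusion_comp_predict : closedInclusion ⋙ predict = 𝟭 SubStoch :=
  CategoryTheory.Functor.ext erase_inf fun _ _ s => castHom_eq (erase_inf _) (erase_inf _) s

/-! Processes between inferential systems -/

namespace FS

/-- The process of `F-S` of a function between systems of inferential wires. -/
def fn {X Y : Sys FinSet} (f : X.Val → Y.Val) : (inf X : FS) ⟶ inf Y :=
  inclusion.map (X := X) (Y := Y) (det f)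

theorem fn_comp {X Y Z : Sys FinSet} (f : X.Val → Y.Val) (g : Y.Val → Z.Val) :
    fn f ≫ fn g = fn (g ∘ f) :=
  (inclusion.map_comp (X := X) (Y := Y) (Z := Z) (det f) (det g)).symm.trans
    (congrArg (inclusion.map (X := X) (Y := Z)) (det_comp_det f g))

theorem fn_comp_assoc {X Y Z : Sys FinSet} (f : X.Val → Y.Val) (g : Y.Val → Z.Val) {a : FS}
    (k : (inf Z : FS) ⟶ a) : fn f ≫ fn g ≫ k = fn (g ∘ f) ≫ k := by
  rw [← Category.assoc, fn_comp]

theorem fn_tensor {X Y X' Y' : Sys FinSet} (f : X.Val → Y.Val) (g : X'.Val → Y'.Val) :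
    tensorMap (fn f) (fn g) = fn (X := .tensor X X') (Y := .tensor Y Y') (Sys.prodMap f g) :=
  (Quotient.sound (Rewrites.infer_tensor (det f) (det g)).symm).trans
    (congrArg (inclusion.map (X := Sys.tensor X X') (Y := Sys.tensor Y Y')) (tensor_det_det f g))

theorem id_inf (X : Sys FinSet) : 𝟙 (inf X : FS) = fn (X := X) id :=
  (inclusion.map_id X).symm

theorem assoc_inf (X Y Z : Sys FinSet) :
    mk (.assoc (inf X) (inf Y) (inf Z)) = fn (Sys.assocEquiv X Y Z) :=
  (Quotient.sound (Rewrites.infer_assoc X Y Z)).symm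

theorem lunit_inf (X : Sys FinSet) : mk (.lunit (inf X)) = fn (Sys.lunitEquiv X) :=
  (Quotient.sound (Rewrites.infer_lunit X)).symm

theorem runit_inf (X : Sys FinSet) : mk (.runit (inf X)) = fn (Sys.runitEquiv X) :=
  (Quotient.sound (Rewrites.infer_runit X)).symm

theorem swap_inf (X Y : Sys FinSet) : mk (.swap (inf X) (inf Y)) = fn (Sys.swapEquiv X Y) :=
  (Quotient.sound (Rewrites.infer_swap X Y)).symm

/-- The rules identify only the forward structural wirings with functions. The inverses follow by
cancelling the forward isomorphism. -/
theorem assocInv_inf (X Y Z : Sys FinSet) :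
    mk (.assocInv (inf X) (inf Y) (inf Z)) = fn (Sys.assocEquiv X Y Z).symm := by
  refine (cancel_epi (α_ (inf X : FS) (inf Y) (inf Z)).hom).1 ?_
  refine (α_ (inf X : FS) (inf Y) (inf Z)).hom_inv_id.trans ?_
  refine Eq.trans ?_ (congrArg (· ≫ fn (Sys.assocEquiv X Y Z).symm) (assoc_inf X Y Z).symm)
  refine Eq.trans ?_ (fn_comp (X := .tensor (.tensor X Y) Z) (Z := .tensor (.tensor X Y) Z) _ _).symm
  rw [Equiv.symm_comp_self]
  exact id_inf (.tensor (.tensor X Y) Z)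

theorem lunitInv_inf (X : Sys FinSet) :
    mk (.lunitInv (inf X)) = fn (Sys.lunitEquiv X).symm := by
  refine (cancel_epi (λ_ (inf X : FS)).hom).1 ?_
  refine (λ_ (inf X : FS)).hom_inv_id.trans ?_
  refine Eq.trans ?_ (congrArg (· ≫ fn (Sys.lunitEquiv X).symm) (lunit_inf X).symm)
  refine Eq.trans ?_ (fn_comp (X := .tensor .unit X) (Z := .tensor .unit X) _ _).symm
  rw [Equiv.symm_comp_self]
  exact id_inf (.tensor .unit X)

theorem runitInv_inf (X : Sys FinSet) :
    mk (.runitInv (inf X)) = fn (Sys.runitEquiv X).symm := by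
  refine (cancel_epi (ρ_ (inf X : FS)).hom).1 ?_
  refine (ρ_ (inf X : FS)).hom_inv_id.trans ?_
  refine Eq.trans ?_ (congrArg (· ≫ fn (Sys.runitEquiv X).symm) (runit_inf X).symm)
  refine Eq.trans ?_ (fn_comp (X := .tensor X .unit) (Z := .tensor X .unit) _ _).symm
  rw [Equiv.symm_comp_self]
  exact id_inf (.tensor X .unit)

theorem tensorMap_comp {a b c a' b' c' : FS} (f : a ⟶ b) (g : b ⟶ c) (f' : a' ⟶ b')
    (g' : b' ⟶ c') : tensorMap (f ≫ g) (f' ≫ g') = tensorMap f f' ≫ tensorMap g g' :=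
  (tensorHom_comp_tensorHom f f' g g').symm

theorem mid_inf (X Y Z W : Sys FinSet) :
    mk (.mid (inf X) (inf Y) (inf Z) (inf W)) = fn (midEquiv X Y Z W) := by
  change mk (.assoc (inf X) (inf Y) (inf (.tensor Z W))) ≫
    tensorMap (𝟙 (inf X : FS)) (mk (.assocInv (inf Y) (inf Z) (inf W))) ≫
    tensorMap (𝟙 (inf X : FS)) (tensorMap (mk (.swap (inf Y) (inf Z))) (𝟙 (inf W : FS))) ≫
    tensorMap (𝟙 (inf X : FS)) (mk (.assoc (inf Z) (inf Y) (inf W))) ≫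
    mk (.assocInv (inf X) (inf Z) (inf (.tensor Y W))) = _
  rw [assoc_inf, assoc_inf, assocInv_inf, assocInv_inf, swap_inf, id_inf, id_inf, fn_tensor,
    fn_tensor, fn_tensor, fn_tensor]
  simp only [fn_comp]
  rfl

/-! ### Preparations of causal systems, and how the generators act on them. -/

/-- Specification of the state of knowledge about the dynamics. -/
abbrev know (A B : Sys FinSet) : (Sys.tensor (caus A) (inf (funcSys A B)) : FS) ⟶ caus B :=
  mk (.know A B)

/-- The causal system `A` in the state described by a state of knowledge about `A`, obtained by
specifying the dynamics from the trivial system to `A`. -/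
def prepare (A : Sys FinSet) : (inf A : FS) ⟶ caus A :=
  -- `caus .unit` and `inf .unit` are both `.unit`, so the source of `know .unit A` is an
  -- inferential system and a function can be composed into it.
  fn (X := A) (Y := .tensor .unit (funcSys .unit A)) (fun a => ((), fun _ => a)) ≫ know .unit A

theorem know_comp_know (A B C : Sys FinSet) :
    tensorMap (know A B) (fn (X := funcSys B C) id) ≫ know B C =
      mk (.assoc (caus A) (inf (funcSys A B)) (inf (funcSys B C))) ≫
        tensorMap (𝟙 (caus A : FS))
          (fn (X := .tensor (funcSys A B) (funcSys B C)) (Y := funcSys A C)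
            fun p : Func A B × Func B C => p.2 ∘ p.1) ≫
        know A C := by
  rw [← id_inf]
  exact Quotient.sound (.know_comp A B C)

/-- Two successive specifications merge into one. As the first starts from the trivial system, all
that precedes the merged `know` is inferential and collapses to one function. -/
theorem fn_tensor_know (A B : Sys FinSet) {X : Sys FinSet}
    (f : X.Val → Unit × Func .unit A) :
    tensorMap (fn (X := X) (Y := .tensor .unit (funcSys .unit A)) f ≫ know .unit A)
        (fn (X := funcSys A B) id) ≫ know A B =
      fn (X := .tensor X (funcSys A B)) (Y := .tensor .unit (funcSys .unit B))
        (fun p : X.Val × Func A B => ((), p.2 ∘ (f p.1).2)) ≫ know .unit B := by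
  have h : tensorMap (fn (X := X) (Y := .tensor .unit (funcSys .unit A)) f ≫ know .unit A)
        (fn (X := funcSys A B) id) =
      tensorMap (fn (X := X) (Y := .tensor .unit (funcSys .unit A)) f)
        (fn (X := funcSys A B) id) ≫ tensorMap (know .unit A) (fn (X := funcSys A B) id) := by
    rw [← tensorMap_comp, fn_comp]
    rfl
  rw [h, Category.assoc, know_comp_know]
  -- Reading `caus .unit` as `inf .unit` makes the associator a wiring of inferential systems, hence
  -- a function.
  change _ ≫ mk (.assoc (inf .unit) (inf (funcSys .unit A)) (inf (funcSys A B))) ≫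
    tensorMap (𝟙 (inf .unit : FS)) _ ≫ know .unit B = _
  rw [assoc_inf, id_inf, fn_tensor, fn_tensor]
  simp only [fn_comp_assoc]
  rfl

theorem prepare_know (A B : Sys FinSet) :
    tensorMap (prepare A) (𝟙 (inf (funcSys A B) : FS)) ≫ know A B =
      fn (X := .tensor A (funcSys A B)) (Y := B) (fun p : A.Val × Func A B => p.2 p.1) ≫
        prepare B := by
  rw [id_inf, prepare, prepare, fn_tensor_know, fn_comp_assoc]
  rfl

theorem ignore_unit : mk (.ignore .unit) = fn (X := .unit) id :=
  (Quotient.sound Rewrites.ignore_unit).trans (id_inf .unit)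

theorem ignore_unit_unit :
    mk (.ignore (.tensor .unit .unit)) =
      fn (X := .tensor .unit .unit) (Y := .unit) fun _ => () := by
  have h : mk (.ignore (.tensor .unit .unit)) =
      tensorMap (mk (.ignore .unit)) (mk (.ignore .unit)) ≫ mk (.lunit (inf .unit)) :=
    Quotient.sound (.ignore_tensor .unit .unit)
  rw [h, ignore_unit, fn_tensor, lunit_inf]
  exact fn_comp (X := .tensor .unit .unit) (Y := .tensor .unit .unit) (Z := .unit) _ _

theorem know_ignore (A B : Sys FinSet) :
    know A B ≫ mk (.ignore B) =
      tensorMap (mk (.ignore A)) (fn (X := funcSys A B) (Y := .unit) fun _ => ()) ≫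
        fn (X := .tensor .unit .unit) (Y := .unit) (Sys.lunitEquiv .unit) := by
  rw [← lunit_inf]
  exact Quotient.sound (.know_ignore A B)

theorem prepare_ignore (A : Sys FinSet) :
    prepare A ≫ mk (.ignore A) = fn (X := A) (Y := .unit) fun _ => () := by
  rw [prepare, Category.assoc, know_ignore, ignore_unit, fn_tensor]
  exact (fn_comp_assoc _ _ _).trans (fn_comp _ _)

/-- Every dynamics from the trivial system is determined by its output. -/
theorem know_unit_unit :
    know (.tensor .unit .unit) .unit =
      fn (X := .tensor (.tensor .unit .unit) (funcSys (.tensor .unit .unit) .unit)) (Y := .unit)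
        fun _ => () := by
  -- Ignoring the trivial output is the identity, so the rule for `know` followed by `ignore`
  -- computes `know` itself.
  have h := know_ignore (.tensor .unit .unit) .unit
  rw [ignore_unit, ignore_unit_unit, fn_tensor, ← id_inf] at h
  exact (Category.comp_id _).symm.trans (h.trans (fn_comp _ _))

/-- The rule for parallel dynamics produces a specification out of `unit ⊗ unit`, whereas `prepare`
starts from `unit`. The two are compared by factoring a function on `unit ⊗ unit` through `unit` and
applying the rule for successive dynamics, whose first factor is known from `know_unit_unit`. -/
theorem know_tensor_unit_unit (C : Sys FinSet) :
    know (.tensor .unit .unit) C =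
      fn (X := .tensor (.tensor .unit .unit) (funcSys (.tensor .unit .unit) C))
        (Y := .tensor .unit (funcSys .unit C))
        (fun p : (Unit × Unit) × Func (.tensor .unit .unit) C => ((), fun _ => p.2 ((), ()))) ≫
        know .unit C := by
  have h := know_comp_know (.tensor .unit .unit) .unit C
  change _ = mk (.assoc (inf (.tensor .unit .unit)) (inf (funcSys (.tensor .unit .unit) .unit))
    (inf (funcSys .unit C))) ≫ tensorMap (𝟙 (inf (.tensor .unit .unit) : FS)) _ ≫ _ at h
  rw [know_unit_unit, assoc_inf, id_inf, fn_tensor, fn_tensor, fn_comp_assoc] at h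
  -- This map splits a function into the map to `unit` followed by its value there. Recomposing the
  -- two gives back the function, so the right side of `h` becomes `know (.tensor .unit .unit) C`.
  have h' := congrArg (fn (X := .tensor (.tensor .unit .unit) (funcSys (.tensor .unit .unit) C))
    (Y := .tensor (.tensor (.tensor .unit .unit) (funcSys (.tensor .unit .unit) .unit))
      (funcSys .unit C))
    (fun p : (Unit × Unit) × Func (.tensor .unit .unit) C =>
      ((p.1, fun _ => ()), fun _ => p.2 ((), ()))) ≫ ·) h
  refine Eq.trans ?_ (h'.symm.trans ?_)
  · refine Eq.trans ?_ (fn_comp_assoc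
      (X := .tensor (.tensor .unit .unit) (funcSys (.tensor .unit .unit) C))
      (Z := .tensor (.tensor .unit .unit) (funcSys (.tensor .unit .unit) C)) _ _ _).symm
    refine (Category.id_comp _).symm.trans (congrArg (· ≫ know (.tensor .unit .unit) C) ?_)
    exact id_inf (.tensor (.tensor .unit .unit) (funcSys (.tensor .unit .unit) C))
  · exact fn_comp_assoc _ _ _

theorem prepare_unit : prepare .unit = 𝟙 (inf .unit : FS) := by
  have h := prepare_ignore .unit
  rw [ignore_unit, ← id_inf] at h
  exact (Category.comp_id _).symm.trans h

theorem prepare_tensor (A B : Sys FinSet) :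
    prepare (.tensor A B) = tensorMap (prepare A) (prepare B) := by
  have h : tensorMap (know .unit A) (know .unit B) =
      mk (.mid (inf .unit) (inf (funcSys .unit A)) (inf .unit) (inf (funcSys .unit B))) ≫
        tensorMap (𝟙 (inf (.tensor .unit .unit) : FS))
          (fn (X := .tensor (funcSys .unit A) (funcSys .unit B))
            (Y := funcSys (.tensor .unit .unit) (.tensor A B))
            fun p : Func .unit A × Func .unit B => Sys.prodMap p.1 p.2) ≫
          know (.tensor .unit .unit) (.tensor A B) :=
    Quotient.sound (.know_tensor .unit A .unit B)
  rw [prepare, prepare, prepare, tensorMap_comp, h, mid_inf, id_inf, fn_tensor, fn_tensor,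
    know_tensor_unit_unit]
  symm
  refine (fn_comp_assoc _ _ _).trans ?_
  refine (fn_comp_assoc _ _ _).trans ?_
  exact fn_comp_assoc _ _ _

theorem learn_unit :
    mk (.learn .unit) = fn (X := .unit) (Y := .tensor .unit .unit) fun _ => ((), ()) := by
  have h : mk (.learn .unit) ≫ tensorMap (𝟙 (inf .unit : FS))
      (fn (X := .unit) (Y := .unit) fun _ => ()) ≫ mk (.runit (inf .unit)) = 𝟙 (inf .unit : FS) :=
    Quotient.sound (.learn_discard .unit)
  rw [id_inf, fn_tensor, runit_inf] at h
  -- In `h`, `learn .unit` is followed by a bijection of singletons; composing with its inverse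
  -- isolates it.
  have h' := congrArg (· ≫ fn (X := .unit) (Y := .tensor .unit .unit) fun _ => ((), ())) h
  refine Eq.trans ?_ (h'.trans (fn_comp _ _))
  rw [Category.assoc, Category.assoc]
  refine (Category.comp_id _).symm.trans (congrArg (mk (.learn .unit) ≫ ·) ?_)
  refine (id_inf (.tensor .unit .unit)).trans ?_
  refine Eq.trans ?_ ((fn_comp_assoc (X := .tensor .unit .unit) _ _ _).trans
    (fn_comp (X := .tensor .unit .unit) (Z := .tensor .unit .unit) _ _)).symm
  rfl

/-- The interaction rule for `know` and `learn`, taken at trivial input, moves the learning onto the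
dynamics: the constant function is copied, one copy prepares `A` and the other is evaluated to give
back `a`. -/
theorem prepare_learn (A : Sys FinSet) :
    prepare A ≫ mk (.learn A) =
      fn (X := A) (Y := .tensor A A) (fun a => (a, a)) ≫
        tensorMap (prepare A) (𝟙 (inf A : FS)) := by
  have h : know .unit A ≫ mk (.learn A) =
      tensorMap (mk (.learn .unit)) (fn (X := funcSys .unit A)
        (Y := .tensor (funcSys .unit A) (funcSys .unit A)) fun f => (f, f)) ≫
      mk (.mid (inf .unit) (inf .unit) (inf (funcSys .unit A)) (inf (funcSys .unit A))) ≫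
      tensorMap (know .unit A) (fn (X := .tensor .unit (funcSys .unit A)) (Y := A)
        fun p : Unit × Func .unit A => p.2 p.1) :=
    Quotient.sound (.know_learn .unit A)
  -- The inferential half is split off and placed before `know`, so that it can be absorbed into the
  -- functions preceding it.
  have h₁ : tensorMap (know .unit A) (fn (X := .tensor .unit (funcSys .unit A)) (Y := A)
        fun p : Unit × Func .unit A => p.2 p.1) =
      tensorMap (fn (X := .tensor .unit (funcSys .unit A)) id)
        (fn (X := .tensor .unit (funcSys .unit A)) (Y := A)
          fun p : Unit × Func .unit A => p.2 p.1) ≫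
        tensorMap (know .unit A) (𝟙 (inf A : FS)) := by
    rw [← tensorMap_comp, Category.comp_id, ← id_inf]
    exact congrArg (tensorMap · _) (Category.id_comp _).symm
  have h₂ : tensorMap (prepare A) (𝟙 (inf A : FS)) =
      tensorMap (fn (X := A) (Y := .tensor .unit (funcSys .unit A)) (fun a => ((), fun _ => a)))
        (fn (X := A) id) ≫ tensorMap (know .unit A) (𝟙 (inf A : FS)) := by
    rw [← tensorMap_comp, Category.comp_id, ← id_inf]
    rfl
  rw [h₂, prepare, Category.assoc, h, h₁, mid_inf, learn_unit, fn_tensor, fn_tensor, fn_tensor]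
  refine (fn_comp_assoc _ _ _).trans ?_
  refine (fn_comp_assoc _ _ _).trans ?_
  refine (fn_comp_assoc _ _ _).trans ?_
  refine Eq.trans ?_
    (fn_comp_assoc (X := A) (Z := .tensor (.tensor .unit (funcSys .unit A)) A) _ _ _).symm
  rfl

/-! ### Preparation as a natural transformation from evaluation to the identity. -/

/-- The process that turns knowledge about the causal wires of a system into a preparation of those
wires, and leaves its inferential wires alone. -/
def prepareCausal : (a : FS) → ((inf (erase a) : FS) ⟶ a)
  | .unit => 𝟙 (inf .unit : FS)
  | .wire (.causal x) => prepare (.wire x)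
  | .wire (.inferential x) => 𝟙 (inf (.wire x) : FS)
  | .tensor a b => tensorMap (prepareCausal a) (prepareCausal b)

theorem tensorMap_eqToHom {a b a' b' : FS} (h : a = b) (h' : a' = b') :
    tensorMap (eqToHom h) (eqToHom h') = eqToHom (congrArg₂ Sys.tensor h h') := by
  subst h h'
  exact id_tensorHom_id a a'

/-- Preparing a causal system wire by wire agrees with preparing it at once; the inductive step is
`prepare_tensor`. -/
theorem prepareCausal_caus (A : Sys FinSet) :
    prepareCausal (caus A) = eqToHom (congrArg inf (erase_caus A)) ≫ prepare A := by
  induction A with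
  | unit => exact prepare_unit.symm.trans (Category.id_comp _).symm
  | wire x => exact (Category.id_comp _).symm
  | tensor A B hA hB =>
    rw [prepare_tensor]
    refine Eq.trans (congrArg₂ tensorMap hA hB) ((tensorMap_comp _ _ _ _).trans ?_)
    exact congrArg (· ≫ tensorMap (prepare A) (prepare B)) (tensorMap_eqToHom _ _)

/-- This is where causal closedness enters: with no causal wire, every factor of the preparation is
an identity. -/
theorem prepareCausal_of_causallyClosed {a : FS} (h : causallyClosed a) :
    ∃ e : inf (erase a) = a, prepareCausal a = eqToHom e := by
  induction a with
  | unit => exact ⟨rfl, rfl⟩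
  | wire w =>
    cases w with
    | causal x => exact h.elim
    | inferential x => exact ⟨rfl, rfl⟩
  | tensor a b ha hb =>
    obtain ⟨e, he⟩ := ha h.1
    obtain ⟨e', he'⟩ := hb h.2
    exact ⟨congrArg₂ Sys.tensor e e',
      (congrArg₂ tensorMap he he').trans (tensorMap_eqToHom e e')⟩

theorem prepareCausal_inf (X : Sys FinSet) :
    prepareCausal (inf X) = eqToHom (congrArg inf (erase_inf X)) :=
  (prepareCausal_of_causallyClosed (causallyClosed_inf X)).2

theorem infer_castHom {X X' Y Y' : Sys FinSet} (h : X' = X) (h' : Y' = Y)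
    (s : SubStoch.Hom X Y) {a : FS} (k : (inf Y' : FS) ⟶ a) :
    mk (.infer (castHom h h' s)) ≫ k =
      (eqToHom (congrArg inf h) : (inf X' : FS) ⟶ inf X) ≫ mk (.infer s) ≫
        (eqToHom (congrArg inf h'.symm) : (inf Y : FS) ⟶ inf Y') ≫ k := by
  subst h h'
  exact ((Category.id_comp _).trans (congrArg (_ ≫ ·) (Category.id_comp _))).symm

theorem eqToHom_comp_eqToHom_comp {a b c : FS} (h : a = b) (h' : b = a) (k : a ⟶ c) :
    eqToHom h ≫ eqToHom h' ≫ k = k := by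
  subst h
  exact (Category.id_comp _).trans (Category.id_comp _)

/-- Preparing the causal wires is natural: every process of `F-S` acts on prepared causal wires as
its substochastic reading. -/
theorem prepareCausal_naturality {a b : FS} (f : Diagram a b) :
    prepareCausal a ≫ mk f = mk (.infer f.eval) ≫ prepareCausal b := by
  induction f with
  | ident a =>
    refine (Category.comp_id _).trans ((Category.id_comp _).symm.trans ?_)
    exact congrArg (· ≫ prepareCausal a) (id_inf (erase a))
  | @comp a b c f g hf hg =>
    refine (Category.assoc _ _ _).symm.trans ((congrArg (· ≫ mk g) hf).trans ?_)
    refine (Category.assoc _ _ _).trans ((congrArg (mk (.infer f.eval) ≫ ·) hg).trans ?_)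
    refine (Category.assoc _ _ _).symm.trans (congrArg (· ≫ prepareCausal c) ?_)
    exact Quotient.sound (Rewrites.infer_comp f.eval g.eval).symm
  | @tensor a b a' b' f g hf hg =>
    refine (tensorMap_comp _ _ _ _).symm.trans ((congrArg₂ tensorMap hf hg).trans ?_)
    refine (tensorMap_comp _ _ _ _).trans ?_
    exact congrArg (· ≫ prepareCausal (Sys.tensor b b'))
      (Quotient.sound (Rewrites.infer_tensor f.eval g.eval).symm)
  -- For bare wirings the square is naturality of the structural isomorphism, whose inferential
  -- instance is the function used by `eval`.
  | assoc a b c =>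
    refine (associator_naturality (prepareCausal a) (prepareCausal b) (prepareCausal c)).trans ?_
    exact congrArg (· ≫ prepareCausal (Sys.tensor a (.tensor b c))) (assoc_inf _ _ _)
  | assocInv a b c =>
    refine (associator_inv_naturality (prepareCausal a) (prepareCausal b)
      (prepareCausal c)).trans ?_
    exact congrArg (· ≫ prepareCausal (Sys.tensor (.tensor a b) c)) (assocInv_inf _ _ _)
  | lunit a =>
    refine (leftUnitor_naturality (prepareCausal a)).trans ?_
    exact congrArg (· ≫ prepareCausal a) (lunit_inf _)
  | lunitInv a =>
    refine (leftUnitor_inv_naturality (prepareCausal a)).trans ?_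
    exact congrArg (· ≫ prepareCausal (Sys.tensor .unit a)) (lunitInv_inf _)
  | runit a =>
    refine (rightUnitor_naturality (prepareCausal a)).trans ?_
    exact congrArg (· ≫ prepareCausal a) (runit_inf _)
  | runitInv a =>
    refine (rightUnitor_inv_naturality (prepareCausal a)).trans ?_
    exact congrArg (· ≫ prepareCausal (Sys.tensor a .unit)) (runitInv_inf _)
  | swap a b =>
    refine (BraidedCategory.braiding_naturality (prepareCausal a) (prepareCausal b)).trans ?_
    exact congrArg (· ≫ prepareCausal (Sys.tensor b a)) (swap_inf _ _)
  -- Both ends are inferential, so the two preparations are equalities of objects, and the one at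
  -- the target cancels the cast in `eval`.
  | @infer X Y s =>
    refine Eq.trans ?_ (infer_castHom (erase_inf X) (erase_inf Y) s _).symm
    rw [prepareCausal_inf, prepareCausal_inf, eqToHom_trans, eqToHom_refl, Category.comp_id]
  -- For the three interaction generators, the casts in `eval` cancel against those of
  -- `prepareCausal_caus` and `prepareCausal_inf`, leaving `prepare_know`, `prepare_learn` and
  -- `prepare_ignore`.
  | know A B =>
    refine Eq.trans ?_ (infer_castHom (congrArg₂ Sys.tensor (erase_caus A) rfl) (erase_caus B)
      (propagate A B) _).symm
    rw [prepareCausal_caus, eqToHom_comp_eqToHom_comp]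
    refine (congrArg (tensorMap · (𝟙 (inf (funcSys A B) : FS)) ≫ know A B)
      (prepareCausal_caus A)).trans ?_
    have h : tensorMap (eqToHom (congrArg inf (erase_caus A)) ≫ prepare A)
        (𝟙 (inf (funcSys A B) : FS)) =
        (eqToHom (congrArg (Sys.tensor · (inf (funcSys A B))) (congrArg inf (erase_caus A))) :
          (Sys.tensor (inf (erase (caus A))) (inf (funcSys A B)) : FS) ⟶
            Sys.tensor (inf A) (inf (funcSys A B))) ≫
          tensorMap (prepare A) (𝟙 (inf (funcSys A B) : FS)) := by
      refine (congrArg (tensorMap _) (Category.id_comp _).symm).trans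
        ((tensorMap_comp _ _ _ _).trans ?_)
      exact congrArg (· ≫ tensorMap (prepare A) (𝟙 (inf (funcSys A B) : FS)))
        (tensorMap_eqToHom _ rfl)
    rw [h, Category.assoc, prepare_know]
    rfl
  | learn A =>
    refine Eq.trans ?_ (infer_castHom (erase_caus A)
      (congrArg₂ Sys.tensor (erase_caus A) (erase_inf A)) (copy A) _).symm
    have h : prepareCausal (Sys.tensor (caus A) (inf A)) =
        (eqToHom (congrArg inf (congrArg₂ Sys.tensor (erase_caus A) (erase_inf A))) :
          (inf (erase (Sys.tensor (caus A) (inf A))) : FS) ⟶ inf (.tensor A A)) ≫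
          tensorMap (prepare A) (𝟙 (inf A : FS)) := by
      refine (congrArg₂ tensorMap (prepareCausal_caus A)
        ((prepareCausal_inf A).trans (Category.comp_id _).symm)).trans
        ((tensorMap_comp _ _ _ _).trans ?_)
      exact congrArg (· ≫ tensorMap (prepare A) (𝟙 (inf A : FS))) (tensorMap_eqToHom _ _)
    rw [h, eqToHom_comp_eqToHom_comp, prepareCausal_caus, Category.assoc, prepare_learn]
    rfl
  | ignore A =>
    refine Eq.trans ?_ (infer_castHom (erase_caus A) rfl (SubStoch.discard A) _).symm
    rw [prepareCausal_caus, Category.assoc, prepare_ignore]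
    refine congrArg (_ ≫ ·) ?_
    exact ((congrArg (_ ≫ ·) (Category.id_comp _)).trans (Category.comp_id _)).symm

end FS

/-! ### Uniqueness: `predict` is inverse to the inclusion. -/

/-- Between causally closed systems the naturality square has `eqToHom` on both vertical sides, so
it says that a process is its own evaluation transported along equalities of objects, which is what
equality of functors requires. -/
theorem predict_comp_closedInclusion : predict ⋙ closedInclusion = 𝟭 ClosedFS := by
  have e (a : ClosedFS) : inf (erase a.obj) = a.obj :=
    (FS.prepareCausal_of_causallyClosed a.property).1
  have he (a : ClosedFS) : FS.prepareCausal a.obj = eqToHom (e a) :=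
    (FS.prepareCausal_of_causallyClosed a.property).2
  refine CategoryTheory.Functor.ext
    (fun a => ObjectProperty.FullSubcategory.ext (e a)) fun a b f => ?_
  obtain ⟨f⟩ := f
  obtain ⟨f, rfl⟩ := Quotient.exists_rep f
  refine FS.causallyClosed.ι.map_injective ?_
  have h := FS.prepareCausal_naturality f
  rw [he, he] at h
  simp only [Functor.map_comp, eqToHom_map]
  refine Eq.trans ?_ (Category.assoc _ _ _)
  refine Eq.trans ?_ (congrArg (· ≫ eqToHom _) h.symm)
  refine Eq.trans ?_ (Category.assoc _ _ _).symm
  refine Eq.symm ((congrArg (_ ≫ ·) (eqToHom_trans _ _)).trans (Category.comp_id _))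

theorem IsPredictionMap.eq_predict {p : ClosedFS ⥤ SubStoch} (hp : IsPredictionMap p) :
    p = predict :=
  calc p = (predict ⋙ closedInclusion) ⋙ p := by rw [predict_comp_closedInclusion]; rfl
    _ = predict ⋙ (closedInclusion ⋙ p) := rfl
    _ = predict := by rw [hp.left_inverse]; rfl

end CausalInferential

end

theorem theorem4 :
    ∃! p : CausalInferential.ClosedFS ⥤ CausalInferential.SubStoch,
      CausalInferential.IsPredictionMap p :=
  ⟨CausalInferential.predict, ⟨CausalInferential.predict_diagramPreserving,
    CausalInferential.closedInclusion_comp_predict⟩, fun _ hp => hp.eq_predict⟩
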